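/- \textbf{Definitions.} For $e\in\mathbb N^n$ and $z=(z_1,\dots,z_n)$ let $a_e(z)=\det(z_i^{e_j})_{i,j}$, and let $\delta_n=(n-1,\dots,1,0)$. The Schur polynomial of a partition $\alpha$ with $\ell(\alpha)\le n$ is $s_\alpha(z)=a_{\alpha+\delta_n}(z)/a_{\delta_n}(z)$. For $X=\{x_1,x_2\}$, $Y=\{y_1,y_2\}$, $XY=\{x_1y_1,x_1y_2,x_2y_1,x_2y_2\}$ and a partition $\lambda$ with $\ell(\lambda)\le 4$, the Kronecker coefficients $g_{\mu,\nu,\lambda}$ ($\ell(\mu),\ell(\nu)\le 2$) are the coefficients in the expansion \[ s_\lambda[XY]=\sum_{\mu,\nu} g_{\mu,\nu,\lambda}\,s_\mu[X]\,s_\nu[Y]. \] Now put $X=\{1,x\}$, $Y=\{1,y\}$, $XY=\{1,x,y,xy\}$ (as ordered alphabets), and let $S(p)$ denote the lexicographically least term of a polynomial $p$ in $x,y$ (the exponent of $y$ is compared first, then that of $x$). The atomic Kronecker coefficient $\tilde g_{\mu,\nu,\lambda}$ is the coefficient of $x^{\mu_2}y^{\nu_2}$ in \[ \frac{a_{\delta_2}[X]\,a_{\delta_2}[Y]}{a_{\delta_4}[XY]}\;S\bigl(a_{\lambda+\delta_4}[XY]\bigr),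 \] expanded as a Laurent series in the region $0<|xy|<|y|<|x|<1$, i.e. as a Laurent series in $y$ whose coefficients are Laurent series in $x$. \textbf{Statement.} Let $\lambda,\mu,\nu$ be partitions of the same integer with $\ell(\mu),\ell(\nu)\le 2$ and $\ell(\lambda)\le 4$. Then $\tilde g_{\mu,\nu,\lambda}=g_{\mu,\nu,\lambda}$ whenever \begin{enumerate} \item $\lambda_3+\lambda_4\le \nu_2\le \lambda_2+\lambda_4$, and \item $(\lambda_3+\lambda_4)+(\lambda_2+\lambda_4)\le \mu_2+\nu_2\le (\lambda_3+\lambda_4)+\min(\lambda_2+\lambda_3,\ \lambda_1+\lambda_4)$. \end{enumerate} Moreover, when $\lambda_2+\lambda_3\le\lambda_1+\lambda_4$, conditions (1) and (2) together are equivalent to the chain \[ \lambda_4\le \mu_2+\nu_2-(\lambda_2+\lambda_3+\lambda_4)\le \lambda_3\le \nu_2-\lambda_4\le \lambda_2, \] so that this chain is sufficient for $\tilde g_{\mu,\nu,\lambda}=g_{\mu,\nu,\lambda}$. -/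

import Mathlib

open MvPolynomial

/-- The alternant `det (z_i ^ e_j)`. -/
def alternant {R : Type*} [CommRing R] {n : ℕ} (z : Fin n → R) (e : Fin n → ℕ) : R :=
  (Matrix.of fun i j => z i ^ e j).det

/-- The staircase `δ_n = (n-1, n-2, …, 1, 0)`. -/
def staircase (n : ℕ) : Fin n → ℕ := fun i => n - 1 - (i : ℕ)

theorem sub_dvd_alternant {R : Type*} [CommRing R] {n : ℕ} (z : Fin n → R) (e : Fin n → ℕ)
    {i j : Fin n} (hij : i ≠ j) : z i - z j ∣ alternant z e := by
  have h1 : ∀ k, ∃ c, z i ^ e k - z j ^ e k = (z i - z j) * c := fun k =>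
    sub_dvd_pow_sub_pow (z i) (z j) (e k)
  choose c hc using h1
  have h2 := Matrix.det_updateRow_add_smul_self (Matrix.of fun i j => z i ^ e j) hij (-1 : R)
  have h3 : (Matrix.of fun i j => z i ^ e j) i + (-1 : R) • (Matrix.of fun i j => z i ^ e j) j
      = (z i - z j) • c := by
    ext k
    simpa [← sub_eq_add_neg] using hc k
  rw [h3, Matrix.det_updateRow_smul] at h2
  exact ⟨_, h2.symm⟩

theorem alternant_staircase {R : Type*} [CommRing R] {n : ℕ} (z : Fin n → R) :
    alternant z (staircase n) = ∏ i, ∏ j ∈ Finset.Ioi i, (z i - z j) := by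
  have h : (Matrix.of fun i j => z i ^ staircase n j) = Matrix.projVandermonde 1 z := by
    ext i j
    simp [Matrix.projVandermonde_apply, staircase, Fin.val_rev, Nat.sub_sub, Nat.add_comm]
  simp [alternant, h, Matrix.det_projVandermonde]

theorem irreducible_X_sub_X {n : ℕ} {i j : Fin n} (hij : i ≠ j) :
    Irreducible (X i - X j : MvPolynomial (Fin n) ℤ) := by
  have h := irreducible_mul_X_add (1 : MvPolynomial (Fin n) ℤ) (-X j) i one_ne_zero
    (by simp) (by rw [vars_neg, vars_X]; simpa using hij) isRelPrime_one_left
  simpa [sub_eq_add_neg] using h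

/-- The Vandermonde determinant divides every alternant. -/
theorem alternant_dvd_alternant {n : ℕ} (e : Fin n → ℕ) :
    alternant (X : Fin n → MvPolynomial (Fin n) ℤ) (staircase n) ∣ alternant X e := by
  rw [alternant_staircase, Finset.prod_sigma']
  apply Finset.prod_dvd_of_isRelPrime
  · rintro ⟨i, j⟩ hij ⟨k, l⟩ hkl hne
    simp only [Finset.coe_sigma, Set.mem_sigma_iff, Finset.mem_coe, Finset.mem_univ, true_and,
      Finset.mem_Ioi] at hij hkl
    refine ((irreducible_X_sub_X hij.ne).isRelPrime_iff_not_dvd).2 ?_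
    rintro ⟨c, hc⟩
    have h := congrArg (eval fun m : Fin n => if m = j then ((i : ℕ) : ℤ) else ((m : ℕ) : ℤ)) hc
    simp only [map_sub, map_mul, eval_X, hij.ne, if_true, if_false, sub_self, zero_mul] at h
    apply hne
    have h1 : i = k ∧ j = l := by
      simp only [Fin.ext_iff, Fin.lt_def] at *
      split_ifs at h <;> omega
    obtain ⟨rfl, rfl⟩ := h1
    rfl
  · rintro ⟨i, j⟩ hij
    simp only [Finset.mem_sigma, Finset.mem_univ, true_and, Finset.mem_Ioi] at hij
    exact sub_dvd_alternant _ _ hij.ne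

/-- The Schur polynomial `s_α(x_1, …, x_n)`: the quotient `a_{α+δ_n} / a_{δ_n}` of alternants. -/
noncomputable def schurPoly {n : ℕ} (α : Fin n → ℕ) : MvPolynomial (Fin n) ℤ :=
  (alternant_dvd_alternant (α + staircase n)).choose

theorem alternant_mul_schurPoly {n : ℕ} (α : Fin n → ℕ) :
    alternant X (staircase n) * schurPoly α = alternant X (α + staircase n) :=
  (alternant_dvd_alternant (α + staircase n)).choose_spec.symm

/-- `s_λ[XY]`: the Schur polynomial `s_λ` evaluated at the `nm` products
`x_1 y_1, x_1 y_2, …, x_n y_m`, where the `x_i` are the left variables and the `y_j` the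
right variables. -/
noncomputable def schurXY (n m : ℕ) (lam : Fin (n * m) → ℕ) : MvPolynomial (Fin n ⊕ Fin m) ℤ :=
  aeval (fun k => X (Sum.inl (finProdFinEquiv.symm k).1) * X (Sum.inr (finProdFinEquiv.symm k).2))
    (schurPoly lam)

/-- `g` is the (finite) family of coefficients of an expansion
`s_λ[XY] = ∑_{μ,ν} g_{μ,ν} s_μ[X] s_ν[Y]` over pairs of partitions with `ℓ(μ) ≤ n`, `ℓ(ν) ≤ m`. -/
def IsKroneckerExpansion (n m : ℕ) (lam : Fin (n * m) → ℕ)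
    (g : (Fin n → ℕ) × (Fin m → ℕ) →₀ ℤ) : Prop :=
  (∀ p ∈ g.support, Antitone p.1 ∧ Antitone p.2) ∧
    schurXY n m lam =
      g.sum fun p c => C c * rename Sum.inl (schurPoly p.1) * rename Sum.inr (schurPoly p.2)

open Classical in
/-- The Kronecker coefficient `g_{μ,ν,λ}`: the coefficient of `s_μ[X] s_ν[Y]` in the expansion of
`s_λ[XY]`. Such an expansion always exists and is unique, so the value `0` in the `else` branch
is never used for partitions. -/
noncomputable def kroneckerCoeff {n m : ℕ} (mu : Fin n → ℕ) (nu : Fin m → ℕ)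
    (lam : Fin (n * m) → ℕ) : ℤ :=
  if h : ∃ g, IsKroneckerExpansion n m lam g then h.choose (mu, nu) else 0

/-- Laurent series in `y` whose coefficients are Laurent series in `x`: the field in which
rational functions of `x, y` are expanded in the region `0 < |xy| < |y| < |x| < 1`. -/
abbrev IterLaurent : Type := LaurentSeries (LaurentSeries ℚ)

noncomputable def xVar : IterLaurent := HahnSeries.C (HahnSeries.single 1 1)

noncomputable def yVar : IterLaurent := HahnSeries.single 1 1

/-- The coefficient of `x^i y^j`. -/
def coeffXY (f : IterLaurent) (i j : ℤ) : ℚ := (f.coeff j).coeff i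

/-- `S(f)`: the lexicographically least term `c x^i y^j` of `f` (the exponent `j` of `y` is compared
first, in accordance with `|y| < |x|`). -/
noncomputable def leastTerm (f : IterLaurent) : IterLaurent :=
  HahnSeries.single f.order
    (HahnSeries.single f.leadingCoeff.order f.leadingCoeff.leadingCoeff)

/-- The rational function `a_{δ_2}[X] a_{δ_2}[Y] / a_{δ_4}[XY]` at `X = {1, x}`, `Y = {1, y}`,
`XY = {1, x, y, xy}`, times the least term of `a_{λ+δ_4}[XY]`. -/
noncomputable def atomicSeries (lam : Fin 4 → ℕ) : IterLaurent :=
  alternant ![1, xVar] (staircase 2) * alternant ![1, yVar] (staircase 2) /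
      alternant ![1, xVar, yVar, xVar * yVar] (staircase 4) *
    leastTerm (alternant ![1, xVar, yVar, xVar * yVar] (lam + staircase 4))

/-- The atomic Kronecker coefficient `g̃_{μ,ν,λ}`: the coefficient of `x^{μ_2} y^{ν_2}` in
`atomicSeries λ`. -/
noncomputable def atomicCoeff (mu nu : Fin 2 → ℕ) (lam : Fin 4 → ℕ) : ℚ :=
  coeffXY (atomicSeries lam) (mu 1) (nu 1)

/-! Multiplying the Kronecker expansion by a_{δ_2}[X] a_{δ_2}[Y] turns it into a sum of products of
alternants, each with a single monomial whose exponents strictly decrease in both alphabets. Setting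
x_1 = y_1 = 1 loses nothing, by bihomogeneity. Hence g is the coefficient of x^{μ_2} y^{ν_2} in
`deltaRatio` times the full a_{λ+δ_4}[XY] (`kroneckerCoeff_eq_coeffXY`).

The atomic coefficient keeps only the identity permutation in that alternant, so the other
permutations must contribute zero. Since `deltaRatio` is 1 / (x^2 y (1-x)(1-y)(1-xy)(1-x^{-1}y)),
its expansion lives in the cone j ≥ -1, i + j ≥ -3 (`supportedInCone_deltaRatio_mul`). Every other
permutation gives a monomial with larger y-exponent, or with equal y-exponent and larger total
exponent (`exponents_of_perm_ne_one`). The upper bounds on ν_2 and μ_2 + ν_2 place (μ_2, ν_2)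
outside its translated cone. -/

/-! ### Monomials and coefficients of iterated Laurent series -/

/-- The monomial `x^i y^j`. -/
noncomputable def monoXY (i j : ℤ) : IterLaurent := HahnSeries.single j (HahnSeries.single i 1)

theorem xVar_eq : xVar = monoXY 1 0 := rfl

theorem yVar_eq : yVar = monoXY 0 1 := rfl

theorem monoXY_zero : monoXY 0 0 = 1 := rfl

theorem monoXY_mul (i j k l : ℤ) : monoXY i j * monoXY k l = monoXY (i + k) (j + l) := by
  simp [monoXY, HahnSeries.single_mul_single]

theorem monoXY_pow (i j : ℤ) (n : ℕ) : monoXY i j ^ n = monoXY (n * i) (n * j) := by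
  induction n with
  | zero => simp [monoXY_zero]
  | succ n ih => rw [pow_succ, ih, monoXY_mul]; push_cast; ring_nf

theorem xVar_pow_mul_yVar_pow (m n : ℕ) : xVar ^ m * yVar ^ n = monoXY m n := by
  rw [xVar_eq, yVar_eq, monoXY_pow, monoXY_pow, monoXY_mul]; simp

/-- The coefficient of `x^i y^j`, as an additive map. -/
noncomputable def coeffXYHom (i j : ℤ) : IterLaurent →+ ℚ where
  toFun f := coeffXY f i j
  map_zero' := by simp [coeffXY]
  map_add' := by simp [coeffXY]

theorem coeffXYHom_apply (i j : ℤ) (f : IterLaurent) : coeffXYHom i j f = coeffXY f i j := rfl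

theorem coeffXY_monoXY_mul (f : IterLaurent) (s t i j : ℤ) :
    coeffXY (monoXY s t * f) i j = coeffXY f (i - s) (j - t) := by
  simp [coeffXY, monoXY, HahnSeries.coeff_single_mul]

theorem coeffXY_monoXY (i j k l : ℤ) :
    coeffXY (monoXY k l) i j = if i = k ∧ j = l then 1 else 0 := by
  by_cases hj : j = l
  · by_cases hi : i = k <;> simp [coeffXY, monoXY, hi, hj]
  · simp [coeffXY, monoXY, hj]

/-! ### Supports in cones, and least terms -/

/-- The support of `f` lies in the cone `{x^i y^j | j ≥ d, i + j ≥ c}`. -/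
def SupportedInCone (c d : ℤ) (f : IterLaurent) : Prop :=
  ∀ i j, j < d ∨ i + j < c → coeffXY f i j = 0

theorem exists_coeffXY_sub_nsmul_eq_zero (f : IterLaurent) {s t : ℤ}
    (hst : 0 < t ∨ t = 0 ∧ 0 < s) (i j : ℤ) :
    ∃ N : ℕ, coeffXY f (i - N * s) (j - N * t) = 0 := by
  rcases hst with ht | ⟨rfl, hs⟩
  · refine ⟨(j - f.order).toNat + 1, ?_⟩
    have h : f.coeff (j - ((j - f.order).toNat + 1 : ℕ) * t) = 0 := by
      apply HahnSeries.coeff_eq_zero_of_lt_order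
      have := Int.self_le_toNat (j - f.order)
      push_cast
      nlinarith
    rw [coeffXY, h, HahnSeries.coeff_zero]
  · refine ⟨(i - (f.coeff j).order).toNat + 1, ?_⟩
    have h : (f.coeff j).coeff (i - ((i - (f.coeff j).order).toNat + 1 : ℕ) * s) = 0 := by
      apply HahnSeries.coeff_eq_zero_of_lt_order
      have := Int.self_le_toNat (i - (f.coeff j).order)
      push_cast
      nlinarith
    simpa [coeffXY] using h

/-- Outside the cone the coefficients of `f` are invariant under translation by `-(s, t)`, which
stays outside the cone. As `(s, t)` is lexicographically positive, repeated translation leaves the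
support of `f`. -/
theorem SupportedInCone.of_one_sub_mul {c d s t : ℤ} {f : IterLaurent}
    (ht : 0 ≤ t) (hst : 0 ≤ s + t) (hpos : 0 < t ∨ t = 0 ∧ 0 < s)
    (h : SupportedInCone c d ((1 - monoXY s t) * f)) : SupportedInCone c d f := by
  have step : ∀ i j, j < d ∨ i + j < c → coeffXY f i j = coeffXY f (i - s) (j - t) := by
    intro i j hij
    have h1 := h i j hij
    rw [sub_mul, one_mul, ← coeffXYHom_apply, map_sub, coeffXYHom_apply, coeffXYHom_apply,
      coeffXY_monoXY_mul] at h1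
    exact sub_eq_zero.1 h1
  have key : ∀ (N : ℕ) i j, j < d ∨ i + j < c → coeffXY f (i - N * s) (j - N * t) = 0 →
      coeffXY f i j = 0 := by
    intro N
    induction N with
    | zero => intro i j _ h0; simpa using h0
    | succ N ih =>
      intro i j hij h0
      rw [step i j hij]
      apply ih
      · omega
      · rw [← h0]
        push_cast
        ring_nf
  intro i j hij
  obtain ⟨N, hN⟩ := exists_coeffXY_sub_nsmul_eq_zero f hpos i j
  exact key N i j hij hN

theorem leastTerm_eq {f : IterLaurent} {i j : ℤ} (h1 : coeffXY f i j = 1)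
    (h0 : ∀ k l, l < j ∨ l = j ∧ k < i → coeffXY f k l = 0) : leastTerm f = monoXY i j := by
  have hj : f.coeff j ≠ 0 := fun h => by simp [coeffXY, h] at h1
  have hf : f ≠ 0 := fun h => by simp [h] at hj
  have ho : f.order = j := by
    refine le_antisymm (HahnSeries.order_le_of_coeff_ne_zero hj)
      ((HahnSeries.le_order_iff_forall hf).2 fun l hl => ?_)
    ext k
    exact h0 k l (.inl hl)
  have hl : f.leadingCoeff = f.coeff j := by rw [HahnSeries.leadingCoeff_eq, ho]
  have ho' : (f.coeff j).order = i := by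
    refine le_antisymm (HahnSeries.order_le_of_coeff_ne_zero ?_)
      ((HahnSeries.le_order_iff_forall hj).2 fun k hk => h0 k j (.inr ⟨rfl, hk⟩))
    rw [show (f.coeff j).coeff i = 1 from h1]
    exact one_ne_zero
  rw [leastTerm, hl, ho, ho', HahnSeries.leadingCoeff_eq, ho',
    show (f.coeff j).coeff i = 1 from h1, monoXY]

/-! ### Expansion of the prefactor -/

/-- The prefactor `a_{δ_2}[X] a_{δ_2}[Y] / a_{δ_4}[XY]`. -/
noncomputable def deltaRatio : IterLaurent :=
  alternant ![1, xVar] (staircase 2) * alternant ![1, yVar] (staircase 2) /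
      alternant ![1, xVar, yVar, xVar * yVar] (staircase 4)

theorem one_sub_monoXY_ne_zero {s t : ℤ} (h : s ≠ 0 ∨ t ≠ 0) : 1 - monoXY s t ≠ 0 := by
  intro h0
  have h1 : coeffXY (1 - monoXY s t) 0 0 = 1 := by
    rw [← monoXY_zero, ← coeffXYHom_apply, map_sub, coeffXYHom_apply, coeffXYHom_apply,
      coeffXY_monoXY, coeffXY_monoXY]
    simp [show ¬ (0 = s ∧ 0 = t) by omega]
  rw [h0] at h1
  simp [coeffXY] at h1

theorem alternant_staircase_two {R : Type*} [CommRing R] (a b : R) :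
    alternant ![a, b] (staircase 2) = a - b := by
  simp [alternant, staircase, Matrix.det_fin_two]

theorem alternant_staircase_four {R : Type*} [CommRing R] (a b : R) :
    alternant ![1, a, b, a * b] (staircase 4) =
      (1 - a) * (1 - b) * ((1 - a) * (1 - b) * (1 - a * b) * (a * b * (a - b))) := by
  have h4 : Finset.Ioi (0 : Fin 4) = {1, 2, 3} := rfl
  have h5 : Finset.Ioi (1 : Fin 4) = {2, 3} := rfl
  have h6 : Finset.Ioi (2 : Fin 4) = {3} := rfl
  have h7 : Finset.Ioi (3 : Fin 4) = ∅ := rfl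
  rw [alternant_staircase, Fin.prod_univ_four, h4, h5, h6, h7]
  simp
  ring

/-- Writing x - y as x(1 - x^{-1}y) makes each factor 1 minus a lexicographically positive monomial,
up to the monomial x^2 y. -/
theorem alternant_staircase_XY :
    alternant ![1, xVar, yVar, xVar * yVar] (staircase 4) =
      (1 - xVar) * (1 - yVar) * ((1 - xVar) * (1 - yVar) * (1 - monoXY 1 1) *
        ((1 - monoXY (-1) 1) * monoXY 2 1)) := by
  have h2 : xVar * yVar = monoXY 1 1 := by rw [xVar_eq, yVar_eq, monoXY_mul]; norm_num
  have h3 : (1 - monoXY (-1) 1) * monoXY 2 1 = xVar * yVar * (xVar - yVar) := by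
    rw [h2, xVar_eq, yVar_eq, sub_mul, mul_sub, one_mul, monoXY_mul, monoXY_mul, monoXY_mul]
    norm_num
  rw [alternant_staircase_four, h3, ← h2]

theorem alternant_staircase_XY_ne_zero :
    alternant ![1, xVar, yVar, xVar * yVar] (staircase 4) ≠ 0 := by
  rw [alternant_staircase_XY, xVar_eq, yVar_eq]
  have h : monoXY 2 1 ≠ 0 := by simp [monoXY]
  simp [one_sub_monoXY_ne_zero, h]

theorem supportedInCone_monoXY (p q : ℤ) : SupportedInCone (p + q) q (monoXY p q) := by
  intro i j hij
  rw [coeffXY_monoXY, if_neg (by omega)]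

theorem mul_eq_of_mul_eq_mul {R : Type*} [CommRing R] [IsDomain R] {a b c d e f r : R}
    (h : a * b * (a * b * c * (d * e)) ≠ 0) (hr : r * (a * b * (a * b * c * (d * e))) = a * b) :
    d * (c * (b * (a * (r * (e * f))))) = f := by
  refine mul_left_cancel₀ (left_ne_zero_of_mul h) ?_
  linear_combination f * hr

theorem deltaRatio_mul_alternant :
    deltaRatio * alternant ![1, xVar, yVar, xVar * yVar] (staircase 4) =
      (1 - xVar) * (1 - yVar) := by
  rw [deltaRatio, alternant_staircase_two, alternant_staircase_two]
  have h := alternant_staircase_XY_ne_zero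
  generalize alternant ![1, xVar, yVar, xVar * yVar] (staircase 4) = A at h ⊢
  generalize (1 - xVar) * (1 - yVar) = B
  exact div_mul_cancel₀ B h

theorem supportedInCone_deltaRatio_mul (p q : ℤ) :
    SupportedInCone (p + q - 3) (q - 1) (deltaRatio * monoXY p q) := by
  apply SupportedInCone.of_one_sub_mul (s := 1) (t := 0) <;> try norm_num
  apply SupportedInCone.of_one_sub_mul (s := 0) (t := 1) <;> try norm_num
  apply SupportedInCone.of_one_sub_mul (s := 1) (t := 1) <;> try norm_num
  apply SupportedInCone.of_one_sub_mul (s := -1) (t := 1) <;> try norm_num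
  have h := alternant_staircase_XY_ne_zero
  -- Dividing by x^2 y lowers the y-exponent by 1 and the total exponent by 3, hence the shifts in
  -- the cone.
  have h1 : monoXY p q = monoXY 2 1 * monoXY (p - 2) (q - 1) := by rw [monoXY_mul]; ring_nf
  have h2 : (1 - monoXY (-1) 1) * ((1 - monoXY 1 1) * ((1 - monoXY 0 1) *
      ((1 - monoXY 1 0) * (deltaRatio * monoXY p q)))) = monoXY (p - 2) (q - 1) := by
    have hr := deltaRatio_mul_alternant
    rw [alternant_staircase_XY] at h hr
    rw [h1, ← xVar_eq, ← yVar_eq]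
    exact mul_eq_of_mul_eq_mul h hr
  rw [h2]
  have := supportedInCone_monoXY (p - 2) (q - 1)
  rwa [show p - 2 + (q - 1) = p + q - 3 by ring] at this

/-! ### Only the least term contributes -/

theorem alternant_eq_sum {R : Type*} [CommRing R] {n : ℕ} (z : Fin n → R) (e : Fin n → ℕ) :
    alternant z e = ∑ σ : Equiv.Perm (Fin n), Equiv.Perm.sign σ • ∏ i, z i ^ e (σ i) := by
  rw [alternant, ← Matrix.det_transpose, Matrix.det_apply]
  rfl

theorem alternant_XY_eq_sum (e : Fin 4 → ℕ) :
    alternant ![1, xVar, yVar, xVar * yVar] e = ∑ σ : Equiv.Perm (Fin 4),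
      Equiv.Perm.sign σ • monoXY (e (σ 1) + e (σ 3)) (e (σ 2) + e (σ 3)) := by
  rw [alternant_eq_sum]
  refine Finset.sum_congr rfl fun σ _ => ?_
  have h := xVar_pow_mul_yVar_pow (e (σ 1) + e (σ 3)) (e (σ 2) + e (σ 3))
  push_cast at h
  rw [← h, Fin.prod_univ_four]
  congr 1
  change 1 ^ e (σ 0) * xVar ^ e (σ 1) * yVar ^ e (σ 2) * (xVar * yVar) ^ e (σ 3) = _
  rw [one_pow, one_mul, mul_pow, pow_add, pow_add]
  exact mul_mul_mul_comm _ _ _ _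

theorem coeffXY_sum_sign_smul {ι : Type*} (s : Finset ι) (ε : ι → ℤˣ) (f : ι → IterLaurent)
    (i j : ℤ) :
    coeffXY (∑ k ∈ s, ε k • f k) i j = ∑ k ∈ s, ε k • coeffXY (f k) i j := by
  rw [← coeffXYHom_apply, map_sum]
  refine Finset.sum_congr rfl fun k _ => ?_
  rw [Units.smul_def, map_zsmul, Units.smul_def, coeffXYHom_apply]

/-- For a permutation `σ ≠ 1`, one of the entries `σ 2, σ 3` is at most `1`, or
`{σ 2, σ 3} = {2, 3}` and `(σ 1, σ 3)` is one of `(0, 3), (1, 2), (0, 2)`. -/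
theorem perm_four_cases (σ : Equiv.Perm (Fin 4)) (h : σ ≠ 1) :
    ((σ 2 ≤ 1 ∧ σ 2 ≠ σ 3) ∨ (σ 3 ≤ 1 ∧ σ 2 ≠ σ 3)) ∨
      (σ 2 = 2 ∧ σ 3 = 3 ∧ σ 1 = 0) ∨
      (σ 2 = 3 ∧ σ 3 = 2 ∧ (σ 1 = 0 ∨ σ 1 = 1)) := by
  revert σ
  decide

/-- `e 1 + e 3` is the second smallest sum of two distinct entries. If the y-exponent is the
smallest sum `e 2 + e 3`, only three permutations remain, with x-exponents `e 0 + e 3`, `e 0 + e 2`,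
`e 1 + e 2`. -/
theorem exponents_of_perm_ne_one {e : Fin 4 → ℕ} (he : StrictAnti e) {σ : Equiv.Perm (Fin 4)}
    (h : σ ≠ 1) :
    e 1 + e 3 ≤ e (σ 2) + e (σ 3) ∨ (e (σ 2) + e (σ 3) = e 2 + e 3 ∧
      (e 1 + e 2 ≤ e (σ 1) + e (σ 3) ∨ e 0 + e 3 ≤ e (σ 1) + e (σ 3))) := by
  have h01 : e 1 < e 0 := he (by decide)
  have h12 : e 2 < e 1 := he (by decide)
  have h23 : e 3 < e 2 := he (by decide)
  have h3 : ∀ k, e 3 ≤ e k := fun k => he.antitone (Fin.le_last k)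
  rcases perm_four_cases σ h with (⟨h1, -⟩ | ⟨h1, -⟩) | ⟨h2, h3, h1⟩ | ⟨h2, h3, h1⟩
  · exact .inl (Nat.add_le_add (he.antitone h1) (h3 _))
  · exact .inl (by rw [add_comm (e (σ 2))]; exact Nat.add_le_add (he.antitone h1) (h3 _))
  · rw [h1, h2, h3]; omega
  · rcases h1 with h1 | h1 <;> rw [h1, h2, h3] <;> omega

theorem leastTerm_alternant_XY {e : Fin 4 → ℕ} (he : StrictAnti e) :
    leastTerm (alternant ![1, xVar, yVar, xVar * yVar] e) =
      monoXY (e 1 + e 3) (e 2 + e 3) := by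
  have h01 : e 1 < e 0 := he (by decide)
  have h12 : e 2 < e 1 := he (by decide)
  have h23 : e 3 < e 2 := he (by decide)
  apply leastTerm_eq
  · rw [alternant_XY_eq_sum, coeffXY_sum_sign_smul, Finset.sum_eq_single 1]
    · simp [coeffXY_monoXY]
    · intro σ _ hσ
      have := exponents_of_perm_ne_one he hσ
      rw [coeffXY_monoXY, if_neg (by omega), smul_zero]
    · simp
  · intro k l hkl
    rw [alternant_XY_eq_sum, coeffXY_sum_sign_smul]
    refine Finset.sum_eq_zero fun σ _ => ?_
    rw [coeffXY_monoXY]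
    by_cases hσ : σ = 1
    · subst hσ
      rw [if_neg (by simp only [Equiv.Perm.coe_one, id_eq]; omega), smul_zero]
    · have := exponents_of_perm_ne_one he hσ
      rw [if_neg (by omega), smul_zero]

theorem strictAnti_add_staircase {n : ℕ} {lam : Fin n → ℕ} (h : Antitone lam) :
    StrictAnti (lam + staircase n) := by
  intro i j hij
  have h1 := h hij.le
  simp only [Pi.add_apply, staircase]
  omega

/-- In the given range only the least term of `a_{λ+δ_4}[XY]` contributes. -/
theorem atomicCoeff_eq {mu nu : Fin 2 → ℕ} {lam : Fin 4 → ℕ} (hlam : Antitone lam)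
    (h1 : nu 1 ≤ lam 1 + lam 3)
    (h2 : mu 1 + nu 1 ≤ (lam 2 + lam 3) + min (lam 1 + lam 2) (lam 0 + lam 3)) :
    atomicCoeff mu nu lam = coeffXY (deltaRatio *
      alternant ![1, xVar, yVar, xVar * yVar] (lam + staircase 4)) (mu 1) (nu 1) := by
  have he := strictAnti_add_staircase hlam
  have e0 : (lam + staircase 4) 0 = lam 0 + 3 := rfl
  have e1 : (lam + staircase 4) 1 = lam 1 + 2 := rfl
  have e2 : (lam + staircase 4) 2 = lam 2 + 1 := rfl
  have e3 : (lam + staircase 4) 3 = lam 3 := rfl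
  rw [atomicCoeff, atomicSeries, leastTerm_alternant_XY he, ← deltaRatio, alternant_XY_eq_sum,
    Finset.mul_sum]
  simp_rw [mul_smul_comm]
  rw [coeffXY_sum_sign_smul, Finset.sum_eq_single 1]
  · simp
  · intro σ _ hσ
    have h := exponents_of_perm_ne_one he hσ
    rw [e0, e1, e2, e3] at h
    -- After the staircase and cone shifts, the cone begins exactly one past the bound `h1` on ν_2
    -- or the bound `h2` on μ_2 + ν_2.
    rw [supportedInCone_deltaRatio_mul _ _ _ _ (by omega), smul_zero]
  · simp

/-! ### Symmetry and homogeneity of Schur polynomials -/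

theorem map_alternant {R S : Type*} [CommRing R] [CommRing S] (f : R →+* S) {n : ℕ}
    (z : Fin n → R) (e : Fin n → ℕ) : f (alternant z e) = alternant (fun i => f (z i)) e := by
  rw [alternant, RingHom.map_det]
  congr 1
  ext i j
  simp

theorem alternant_comp_perm {R : Type*} [CommRing R] {n : ℕ} (z : Fin n → R) (e : Fin n → ℕ)
    (π : Equiv.Perm (Fin n)) :
    alternant (fun i => z (π i)) e = Equiv.Perm.sign π * alternant z e :=
  Matrix.det_permute π (Matrix.of fun i j => z i ^ e j)

theorem alternant_staircase_ne_zero (n : ℕ) :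
    alternant (X : Fin n → MvPolynomial (Fin n) ℤ) (staircase n) ≠ 0 := by
  rw [alternant_staircase]
  refine Finset.prod_ne_zero_iff.2 fun i _ => Finset.prod_ne_zero_iff.2 fun j hj => ?_
  exact (irreducible_X_sub_X (Finset.mem_Ioi.1 hj).ne).ne_zero

theorem isHomogeneous_alternant {n : ℕ} (e : Fin n → ℕ) :
    (alternant (X : Fin n → MvPolynomial (Fin n) ℤ) e).IsHomogeneous (∑ i, e i) := by
  rw [alternant_eq_sum]
  refine IsHomogeneous.sum _ _ _ fun σ _ => ?_
  rw [Units.smul_def, ← Equiv.sum_comp σ]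
  exact (homogeneousSubmodule (Fin n) ℤ _).smul_mem _
    (IsHomogeneous.prod _ _ _ fun i _ => isHomogeneous_X_pow _ _)

-- The degree `m + n` component of `a * s` is `a` times the degree `n` component of `s`; cancel `a`.
attribute [local instance] MvPolynomial.gradedAlgebra in
theorem isHomogeneous_of_mul_left {σ : Type*} {a s : MvPolynomial σ ℤ} {m n : ℕ}
    (ha : a.IsHomogeneous m) (h0 : a ≠ 0) (h : (a * s).IsHomogeneous (m + n)) :
    s.IsHomogeneous n := by
  have h1 := DirectSum.coe_decompose_mul_add_of_left_mem (homogeneousSubmodule σ ℤ) (j := n)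
    (b := s) ha
  rw [DirectSum.decompose_of_mem_same _ h] at h1
  rw [mul_left_cancel₀ h0 h1]
  exact (DirectSum.decompose (homogeneousSubmodule σ ℤ) s n).2

theorem isHomogeneous_schurPoly {n : ℕ} (α : Fin n → ℕ) :
    (schurPoly α).IsHomogeneous (∑ i, α i) := by
  refine isHomogeneous_of_mul_left (isHomogeneous_alternant (staircase n))
    (alternant_staircase_ne_zero n) ?_
  rw [alternant_mul_schurPoly]
  have h := isHomogeneous_alternant (α + staircase n)
  simp only [Pi.add_apply, Finset.sum_add_distrib] at h
  rwa [add_comm (∑ i, α i)] at h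

/-- Numerator and denominator both acquire the sign of `π`. -/
theorem rename_schurPoly {n : ℕ} (α : Fin n → ℕ) (π : Equiv.Perm (Fin n)) :
    rename π (schurPoly α) = schurPoly α := by
  have h1 : ∀ e : Fin n → ℕ, rename π (alternant (X : Fin n → MvPolynomial (Fin n) ℤ) e) =
      ((Equiv.Perm.sign π : ℤ) : MvPolynomial (Fin n) ℤ) * alternant X e := by
    intro e
    rw [← alternant_comp_perm]
    refine (map_alternant (rename π : MvPolynomial (Fin n) ℤ →ₐ[ℤ] _).toRingHom X e).trans ?_
    simp
  have h2 := congrArg (rename π) (alternant_mul_schurPoly α)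
  rw [map_mul, h1, h1, ← alternant_mul_schurPoly, mul_assoc] at h2
  have h3 : ((Equiv.Perm.sign π : ℤ) : MvPolynomial (Fin n) ℤ) ≠ 0 := by simp
  exact mul_left_cancel₀ (alternant_staircase_ne_zero n) (mul_left_cancel₀ h3 h2)

theorem alternant_mul_aeval_schurPoly {R : Type*} [CommRing R] {n : ℕ} (z : Fin n → R)
    (α : Fin n → ℕ) :
    alternant z (staircase n) * aeval z (schurPoly α) = alternant z (α + staircase n) := by
  have h1 : ∀ e : Fin n → ℕ, aeval z (alternant (X : Fin n → MvPolynomial (Fin n) ℤ) e) =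
      alternant z e := by
    intro e
    refine (map_alternant (aeval z : MvPolynomial (Fin n) ℤ →ₐ[ℤ] R).toRingHom X e).trans ?_
    simp
  rw [← h1, ← h1, ← map_mul, alternant_mul_schurPoly]

theorem aeval_comp_perm_schurPoly {R : Type*} [CommRing R] {n : ℕ} (z : Fin n → R)
    (α : Fin n → ℕ) (π : Equiv.Perm (Fin n)) :
    aeval (z ∘ π) (schurPoly α) = aeval z (schurPoly α) := by
  conv_rhs => rw [← rename_schurPoly α π, aeval_rename]

theorem rename_schurXY {n m : ℕ} (lam : Fin (n * m) → ℕ) (τ : Equiv.Perm (Fin n))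
    (ρ : Equiv.Perm (Fin m)) :
    rename (Sum.map τ ρ) (schurXY n m lam) = schurXY n m lam := by
  let π : Equiv.Perm (Fin (n * m)) :=
    (finProdFinEquiv.symm.trans (Equiv.prodCongr τ ρ)).trans finProdFinEquiv
  rw [schurXY]
  refine Eq.trans ?_ (aeval_comp_perm_schurPoly _ lam π)
  rw [comp_aeval_apply]
  congr 2
  ext1 k
  simp [π, -finProdFinEquiv_symm_apply]

/-- The bidegree of the left and right variables. -/
def bidegree (n m : ℕ) : Fin n ⊕ Fin m → ℕ × ℕ := Sum.elim (fun _ => (1, 0)) (fun _ => (0, 1))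

theorem isWeightedHomogeneous_schurXY {n m : ℕ} (lam : Fin (n * m) → ℕ) :
    (schurXY n m lam).IsWeightedHomogeneous (bidegree n m) (∑ i, lam i, ∑ i, lam i) := by
  rw [schurXY, aeval_def, eval₂_eq']
  refine IsWeightedHomogeneous.sum _ _ _ fun d hd => ?_
  have hN := isHomogeneous_schurPoly lam (mem_support_iff.1 hd)
  have h1 : ∀ k : Fin (n * m), (X (Sum.inl (finProdFinEquiv.symm k).1) *
      X (Sum.inr (finProdFinEquiv.symm k).2) :
        MvPolynomial (Fin n ⊕ Fin m) ℤ).IsWeightedHomogeneous (bidegree n m) (1, 1) := fun k =>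
    (isWeightedHomogeneous_X ℤ (bidegree n m) (Sum.inl _)).mul
      (isWeightedHomogeneous_X ℤ (bidegree n m) (Sum.inr _))
  have h2 := IsWeightedHomogeneous.prod Finset.univ _ _ fun k _ => (h1 k).pow (d k)
  have h3 : ∑ k, d k • ((1, 1) : ℕ × ℕ) = (∑ i, lam i, ∑ i, lam i) := by
    rw [← hN, Finsupp.weight_apply, Finsupp.sum_fintype _ _ (by simp)]
    ext <;> simp [Prod.fst_sum, Prod.snd_sum]
  rw [h3] at h2
  have h4 := (isWeightedHomogeneous_C (bidegree n m) (coeff d (schurPoly lam))).mul h2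
  rwa [zero_add] at h4

/-! ### Alternating polynomials and the Kronecker expansion -/

/-- `a_{δ_2}[X] a_{δ_2}[Y] s_λ[XY]`. -/
noncomputable def altSchurXY (lam : Fin 4 → ℕ) : MvPolynomial (Fin 2 ⊕ Fin 2) ℤ :=
  (X (Sum.inl 0) - X (Sum.inl 1)) * (X (Sum.inr 0) - X (Sum.inr 1)) * schurXY 2 2 lam

theorem isWeightedHomogeneous_altSchurXY (lam : Fin 4 → ℕ) :
    (altSchurXY lam).IsWeightedHomogeneous (bidegree 2 2)
      ((1, 0) + (0, 1) + (∑ i, lam i, ∑ i, lam i)) := by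
  have h := isWeightedHomogeneous_X (σ := Fin 2 ⊕ Fin 2) ℤ (bidegree 2 2)
  exact (((h (.inl 0)).sub (h (.inl 1))).mul ((h (.inr 0)).sub (h (.inr 1)))).mul
    (isWeightedHomogeneous_schurXY (n := 2) (m := 2) lam)

/-- The exponent vector `(a, b; c, d)`. -/
noncomputable def expo (a b c d : ℕ) : Fin 2 ⊕ Fin 2 →₀ ℕ :=
  Finsupp.equivFunOnFinite.symm (Sum.elim ![a, b] ![c, d])

theorem expo_inj {a b c d a' b' c' d' : ℕ} :
    expo a b c d = expo a' b' c' d' ↔ a = a' ∧ b = b' ∧ c = c' ∧ d = d' := by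
  refine ⟨fun h => ?_, by rintro ⟨rfl, rfl, rfl, rfl⟩; rfl⟩
  have h' : ∀ i, expo a b c d i = expo a' b' c' d' i := DFunLike.congr_fun h
  exact ⟨h' (.inl 0), h' (.inl 1), h' (.inr 0), h' (.inr 1)⟩

theorem expo_eta (e : Fin 2 ⊕ Fin 2 →₀ ℕ) :
    expo (e (.inl 0)) (e (.inl 1)) (e (.inr 0)) (e (.inr 1)) = e := by
  ext i
  rcases i with i | i <;> fin_cases i <;> rfl

theorem coeff_altSchurXY_eq_zero {lam : Fin 4 → ℕ} {a b c d : ℕ}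
    (h : ¬ (a + b = ∑ i, lam i + 1 ∧ c + d = ∑ i, lam i + 1)) :
    coeff (expo a b c d) (altSchurXY lam) = 0 := by
  by_contra h0
  apply h
  have h1 := isWeightedHomogeneous_altSchurXY lam h0
  rw [Finsupp.weight_apply, Finsupp.sum_fintype _ _ (by simp)] at h1
  have h2 := congrArg Prod.fst h1
  have h3 := congrArg Prod.snd h1
  simp [bidegree, expo] at h2 h3
  omega

theorem X_pow_mul_eq_monomial_expo (a b c d : ℕ) :
    (X (.inl 0) ^ a * X (.inl 1) ^ b * (X (.inr 0) ^ c * X (.inr 1) ^ d) :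
      MvPolynomial (Fin 2 ⊕ Fin 2) ℤ) = monomial (expo a b c d) 1 := by
  rw [monomial_eq, Finsupp.prod_fintype _ _ (by simp)]
  simp [expo]

/-- Sign changes of the coefficients under the swaps of the left and of the right variables. -/
def IsAlternating (P : MvPolynomial (Fin 2 ⊕ Fin 2) ℤ) : Prop :=
  rename (Sum.map (Equiv.swap 0 1) id) P = -P ∧ rename (Sum.map id (Equiv.swap 0 1)) P = -P

theorem IsAlternating.coeff_left {P : MvPolynomial (Fin 2 ⊕ Fin 2) ℤ} (h : IsAlternating P)
    (a b c d : ℕ) : coeff (expo b a c d) P = -coeff (expo a b c d) P := by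
  have h1 : (expo a b c d).mapDomain (Sum.map (Equiv.swap 0 1) id) = expo b a c d := by
    ext i
    rw [show (Sum.map (Equiv.swap 0 1) id : Fin 2 ⊕ Fin 2 → _) =
      Equiv.sumCongr (Equiv.swap 0 1) (Equiv.refl _) from rfl, Finsupp.mapDomain_equiv_apply]
    rcases i with i | i <;> fin_cases i <;> rfl
  have h2 := coeff_rename_mapDomain (Sum.map (Equiv.swap 0 1) id)
    ((Equiv.injective _).sumMap Function.injective_id) P (expo a b c d)
  rw [h1, h.1, coeff_neg] at h2
  omega

theorem IsAlternating.coeff_right {P : MvPolynomial (Fin 2 ⊕ Fin 2) ℤ} (h : IsAlternating P)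
    (a b c d : ℕ) : coeff (expo a b d c) P = -coeff (expo a b c d) P := by
  have h1 : (expo a b c d).mapDomain (Sum.map id (Equiv.swap 0 1)) = expo a b d c := by
    ext i
    rw [show (Sum.map id (Equiv.swap 0 1) : Fin 2 ⊕ Fin 2 → _) =
      Equiv.sumCongr (Equiv.refl _) (Equiv.swap 0 1) from rfl, Finsupp.mapDomain_equiv_apply]
    rcases i with i | i <;> fin_cases i <;> rfl
  have h2 := coeff_rename_mapDomain (Sum.map id (Equiv.swap 0 1))
    (Function.injective_id.sumMap (Equiv.injective _)) P (expo a b c d)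
  rw [h1, h.2, coeff_neg] at h2
  omega

/-- Swaps make any unequal exponents decreasing, and a repeated exponent forces a coefficient equal
to its own negative. -/
theorem IsAlternating.ext {P Q : MvPolynomial (Fin 2 ⊕ Fin 2) ℤ} (hP : IsAlternating P)
    (hQ : IsAlternating Q)
    (h : ∀ a b c d, b < a → d < c → coeff (expo a b c d) P = coeff (expo a b c d) Q) :
    P = Q := by
  have h1 : ∀ a b c d, d < c → coeff (expo a b c d) P = coeff (expo a b c d) Q := by
    intro a b c d hcd
    rcases lt_trichotomy a b with hab | rfl | hab
    · rw [hP.coeff_left, hQ.coeff_left, h _ _ _ _ hab hcd]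
    · have := hP.coeff_left a a c d
      have := hQ.coeff_left a a c d
      omega
    · exact h _ _ _ _ hab hcd
  ext e
  rw [← expo_eta e]
  generalize e (.inl 0) = a, e (.inl 1) = b, e (.inr 0) = c, e (.inr 1) = d
  rcases lt_trichotomy c d with hcd | rfl | hcd
  · rw [hP.coeff_right, hQ.coeff_right, h1 _ _ _ _ hcd]
  · have := hP.coeff_right a b c c
    have := hQ.coeff_right a b c c
    omega
  · exact h1 _ _ _ _ hcd

theorem isAlternating_altSchurXY (lam : Fin 4 → ℕ) : IsAlternating (altSchurXY lam) := by
  have h1 := rename_schurXY (n := 2) (m := 2) lam (Equiv.swap 0 1) (Equiv.refl _)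
  have h2 := rename_schurXY (n := 2) (m := 2) lam (Equiv.refl _) (Equiv.swap 0 1)
  rw [Equiv.coe_refl] at h1 h2
  constructor
  · rw [altSchurXY, map_mul, h1]
    simp
    ring
  · rw [altSchurXY, map_mul, h2]
    simp
    ring

/-- `a_{μ+δ_2}[X] a_{ν+δ_2}[Y]`. -/
noncomputable def alternantXY (p : (Fin 2 → ℕ) × (Fin 2 → ℕ)) : MvPolynomial (Fin 2 ⊕ Fin 2) ℤ :=
  rename Sum.inl (alternant X (p.1 + staircase 2)) *
    rename Sum.inr (alternant X (p.2 + staircase 2))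

theorem alternantXY_eq (p : (Fin 2 → ℕ) × (Fin 2 → ℕ)) : alternantXY p =
    (X (.inl 0) ^ (p.1 0 + 1) * X (.inl 1) ^ p.1 1 -
      X (.inl 0) ^ p.1 1 * X (.inl 1) ^ (p.1 0 + 1)) *
    (X (.inr 0) ^ (p.2 0 + 1) * X (.inr 1) ^ p.2 1 -
      X (.inr 0) ^ p.2 1 * X (.inr 1) ^ (p.2 0 + 1)) := by
  simp [alternantXY, alternant, Matrix.det_fin_two, staircase]

theorem alternantXY_eq_mul_schurPoly (p : (Fin 2 → ℕ) × (Fin 2 → ℕ)) : alternantXY p =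
    (X (Sum.inl 0) - X (Sum.inl 1)) * (X (Sum.inr 0) - X (Sum.inr 1)) *
      (rename Sum.inl (schurPoly p.1) * rename Sum.inr (schurPoly p.2)) := by
  have h : alternant (X : Fin 2 → MvPolynomial (Fin 2) ℤ) (staircase 2) = X 0 - X 1 := by
    simp [alternant, staircase, Matrix.det_fin_two]
  rw [alternantXY, ← alternant_mul_schurPoly, ← alternant_mul_schurPoly, h]
  simp only [map_mul, map_sub, rename_X]
  ring

theorem isAlternating_alternantXY (p : (Fin 2 → ℕ) × (Fin 2 → ℕ)) :
    IsAlternating (alternantXY p) := by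
  rw [alternantXY_eq]
  constructor <;> (simp; ring)

theorem coeff_alternantXY {p : (Fin 2 → ℕ) × (Fin 2 → ℕ)} (h1 : Antitone p.1)
    (h2 : Antitone p.2) {a b c d : ℕ} (hab : b < a) (hcd : d < c) :
    coeff (expo a b c d) (alternantXY p) = if p = (![a - 1, b], ![c - 1, d]) then 1 else 0 := by
  have h1' : p.1 1 ≤ p.1 0 := h1 (by decide)
  have h2' : p.2 1 ≤ p.2 0 := h2 (by decide)
  have hp : p = (![a - 1, b], ![c - 1, d]) ↔
      p.1 0 + 1 = a ∧ p.1 1 = b ∧ p.2 0 + 1 = c ∧ p.2 1 = d := by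
    rw [Prod.ext_iff, funext_iff, funext_iff, Fin.forall_fin_two, Fin.forall_fin_two]
    simp
    omega
  rw [alternantXY_eq, sub_mul, mul_sub, mul_sub]
  simp only [X_pow_mul_eq_monomial_expo, coeff_sub, coeff_monomial, expo_inj]
  rw [if_neg (c := _ ∧ _ ∧ p.2 1 = c ∧ _) (by omega), if_neg (c := p.1 1 = a ∧ _) (by omega),
    if_neg (c := p.1 1 = a ∧ _) (by omega)]
  simp only [hp, sub_zero]

/-- `∑ g_{μ,ν} a_{μ+δ_2}[X] a_{ν+δ_2}[Y]`. -/
noncomputable def alternantSum (g : (Fin 2 → ℕ) × (Fin 2 → ℕ) →₀ ℤ) :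
    MvPolynomial (Fin 2 ⊕ Fin 2) ℤ :=
  g.sum fun p c => C c * alternantXY p

theorem isAlternating_alternantSum (g : (Fin 2 → ℕ) × (Fin 2 → ℕ) →₀ ℤ) :
    IsAlternating (alternantSum g) := by
  constructor
  · simp [alternantSum, Finsupp.sum, (isAlternating_alternantXY _).1]
  · simp [alternantSum, Finsupp.sum, (isAlternating_alternantXY _).2]

theorem coeff_alternantSum {g : (Fin 2 → ℕ) × (Fin 2 → ℕ) →₀ ℤ}
    (hg : ∀ p ∈ g.support, Antitone p.1 ∧ Antitone p.2) {a b c d : ℕ} (hab : b < a)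
    (hcd : d < c) :
    coeff (expo a b c d) (alternantSum g) = g (![a - 1, b], ![c - 1, d]) := by
  rw [alternantSum, Finsupp.sum, coeff_sum]
  calc _ = ∑ p ∈ g.support, if p = (![a - 1, b], ![c - 1, d]) then g p else 0 := by
        refine Finset.sum_congr rfl fun p hp => ?_
        rw [coeff_C_mul, coeff_alternantXY (hg p hp).1 (hg p hp).2 hab hcd, mul_ite, mul_one,
          mul_zero]
    _ = _ := by
        rw [Finset.sum_ite_eq']
        split_ifs with h
        · rfl
        · exact (Finsupp.notMem_support_iff.1 h).symm

theorem isKroneckerExpansion_iff {lam : Fin 4 → ℕ} {g : (Fin 2 → ℕ) × (Fin 2 → ℕ) →₀ ℤ} :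
    IsKroneckerExpansion 2 2 lam g ↔ (∀ p ∈ g.support, Antitone p.1 ∧ Antitone p.2) ∧
      altSchurXY lam = alternantSum g := by
  refine and_congr_right fun _ => ?_
  have h : ∀ i j : Fin 2 ⊕ Fin 2, i ≠ j → (X i - X j : MvPolynomial (Fin 2 ⊕ Fin 2) ℤ) ≠ 0 :=
    fun i j hij => sub_ne_zero.2 fun h => hij (X_injective h)
  have h0 := mul_ne_zero (h (.inl 0) (.inl 1) (by decide)) (h (.inr 0) (.inr 1) (by decide))
  have h2 : alternantSum g = (X (Sum.inl 0) - X (Sum.inl 1)) * (X (Sum.inr 0) - X (Sum.inr 1)) *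
      g.sum fun p c => C c * rename Sum.inl (schurPoly p.1) * rename Sum.inr (schurPoly p.2) := by
    rw [alternantSum, Finsupp.sum, Finsupp.sum, Finset.mul_sum]
    refine Finset.sum_congr rfl fun p _ => ?_
    rw [alternantXY_eq_mul_schurPoly]
    ring
  rw [h2, altSchurXY]
  exact (mul_right_inj' h0).symm

-- The coefficients of `altSchurXY lam` at strictly decreasing exponents, shifted by δ_2, form the
-- expansion; alternation settles all other exponents.
open Classical in
theorem exists_isKroneckerExpansion (lam : Fin 4 → ℕ) : ∃ g, IsKroneckerExpansion 2 2 lam g := by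
  let g : (Fin 2 → ℕ) × (Fin 2 → ℕ) →₀ ℤ := Finsupp.onFinset
    ((altSchurXY lam).support.image fun e =>
      (![e (.inl 0) - 1, e (.inl 1)], ![e (.inr 0) - 1, e (.inr 1)]))
    (fun p => if Antitone p.1 ∧ Antitone p.2 then
      coeff (expo (p.1 0 + 1) (p.1 1) (p.2 0 + 1) (p.2 1)) (altSchurXY lam) else 0) (by
      intro p hp
      have h : coeff (expo (p.1 0 + 1) (p.1 1) (p.2 0 + 1) (p.2 1)) (altSchurXY lam) ≠ 0 :=
        fun h => hp (by simp [h])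
      refine Finset.mem_image.2 ⟨_, mem_support_iff.2 h, ?_⟩
      ext i <;> fin_cases i <;> rfl)
  have hg : ∀ p ∈ g.support, Antitone p.1 ∧ Antitone p.2 := by
    intro p hp
    by_contra h
    exact Finsupp.mem_support_iff.1 hp (if_neg h)
  refine ⟨g, isKroneckerExpansion_iff.2 ⟨hg, ?_⟩⟩
  refine (isAlternating_altSchurXY lam).ext (isAlternating_alternantSum g) fun a b c d hab hcd => ?_
  rw [coeff_alternantSum hg hab hcd]
  have h : ∀ {a b : ℕ}, b < a → Antitone ![a - 1, b] := by
    intro a b hab i j hij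
    fin_cases i <;> fin_cases j <;> simp at hij ⊢
    omega
  symm
  refine (if_pos ⟨h hab, h hcd⟩).trans ?_
  simp [Nat.sub_add_cancel (Nat.one_le_of_lt hab), Nat.sub_add_cancel (Nat.one_le_of_lt hcd)]

/-- Every expansion has these coefficients, so the choice in `kroneckerCoeff` is immaterial. -/
theorem kroneckerCoeff_eq_coeff {mu nu : Fin 2 → ℕ} (hmu : Antitone mu) (hnu : Antitone nu)
    (lam : Fin 4 → ℕ) :
    kroneckerCoeff (n := 2) (m := 2) mu nu lam =
      coeff (expo (mu 0 + 1) (mu 1) (nu 0 + 1) (nu 1)) (altSchurXY lam) := by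
  have h := exists_isKroneckerExpansion lam
  obtain ⟨h1, h2⟩ := isKroneckerExpansion_iff.1 h.choose_spec
  have hmu' : mu 1 ≤ mu 0 := hmu (by decide)
  have hnu' : nu 1 ≤ nu 0 := hnu (by decide)
  rw [h2, coeff_alternantSum h1 (by omega) (by omega), kroneckerCoeff]
  refine (dif_pos h).trans ?_
  congr 1
  ext i <;> fin_cases i <;> rfl

/-! ### Specialisation to {1, x} and {1, y} -/

theorem aeval_schurXY {R : Type*} [CommRing R] (x y : R) (lam : Fin 4 → ℕ) :
    aeval (Sum.elim ![1, x] ![1, y]) (schurXY 2 2 lam) =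
      aeval ![1, x, y, x * y] (schurPoly lam) := by
  rw [schurXY, comp_aeval_apply]
  -- `finProdFinEquiv` lists the products as 1, y, x, xy, so the two middle entries are swapped.
  refine Eq.trans ?_ (aeval_comp_perm_schurPoly ![1, x, y, x * y] lam (Equiv.swap 1 2))
  congr 2
  ext1 k
  rw [map_mul, aeval_X, aeval_X]
  fin_cases k
  · exact mul_one 1
  · exact one_mul y
  · exact mul_one x
  · rfl

/-- Evaluation at `X = {1, x}`, `Y = {1, y}`. -/
noncomputable def evalXY {R : Type*} [CommRing R] (x y : R) :
    MvPolynomial (Fin 2 ⊕ Fin 2) ℤ →+* R :=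
  (aeval (Sum.elim ![1, x] ![1, y]) : MvPolynomial (Fin 2 ⊕ Fin 2) ℤ →ₐ[ℤ] R).toRingHom

theorem evalXY_altSchurXY {R : Type*} [CommRing R] {x y r : R} (lam : Fin 4 → ℕ)
    (h : r * alternant ![1, x, y, x * y] (staircase 4) = (1 - x) * (1 - y)) :
    evalXY x y (altSchurXY lam) = r * alternant ![1, x, y, x * y] (lam + staircase 4) := by
  have h1 : evalXY x y (altSchurXY lam) =
      (1 - x) * (1 - y) * aeval ![1, x, y, x * y] (schurPoly lam) := by
    rw [← aeval_schurXY, altSchurXY]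
    simp [evalXY]
  rw [h1, ← h, mul_assoc, alternant_mul_aeval_schurPoly]

theorem evalXY_monomial {R : Type*} [CommRing R] (x y : R) (e : Fin 2 ⊕ Fin 2 →₀ ℕ) (c : ℤ) :
    evalXY x y (monomial e c) = c • (x ^ e (.inl 1) * y ^ e (.inr 1)) := by
  change aeval (Sum.elim ![1, x] ![1, y]) (monomial e c) = _
  rw [aeval_monomial, Finsupp.prod_fintype _ _ (fun _ => pow_zero _)]
  simp

theorem coeffXY_evalXY_monomial (e : Fin 2 ⊕ Fin 2 →₀ ℕ) (c i j : ℤ) :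
    coeffXY (evalXY xVar yVar (monomial e c)) i j =
      c • if i = e (.inl 1) ∧ j = e (.inr 1) then (1 : ℚ) else 0 := by
  rw [evalXY_monomial, xVar_pow_mul_yVar_pow, ← coeffXYHom_apply, map_zsmul, coeffXYHom_apply,
    coeffXY_monoXY]

/-- The fixed bidegree recovers `a` and `c` from `b` and `d`, so no two monomials of `altSchurXY
lam` merge. -/
theorem coeffXY_evalXY_altSchurXY (lam : Fin 4 → ℕ) {a b c d : ℕ}
    (hab : a + b = ∑ i, lam i + 1) (hcd : c + d = ∑ i, lam i + 1) :
    coeffXY (evalXY xVar yVar (altSchurXY lam)) b d = coeff (expo a b c d) (altSchurXY lam) := by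
  conv_lhs => rw [(altSchurXY lam).as_sum]
  rw [map_sum, ← coeffXYHom_apply, map_sum, Finset.sum_eq_single (expo a b c d)]
  · rw [coeffXYHom_apply, coeffXY_evalXY_monomial]
    simp [expo]
  · intro e he hne
    rw [coeffXYHom_apply, coeffXY_evalXY_monomial, if_neg, smul_zero]
    rintro ⟨h1, h2⟩
    apply hne
    rw [mem_support_iff, ← expo_eta e] at he
    have h := not_imp_comm.1 coeff_altSchurXY_eq_zero he
    rw [← expo_eta e, expo_inj]
    omega
  · intro h
    rw [coeffXYHom_apply, coeffXY_evalXY_monomial, notMem_support_iff.1 h, zero_smul]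

/-- `g_{μ,ν,λ}` is the coefficient of `x^{μ_2} y^{ν_2}` in
`a_{δ_2}[X] a_{δ_2}[Y] a_{λ+δ_4}[XY] / a_{δ_4}[XY]`. -/
theorem kroneckerCoeff_eq_coeffXY {mu nu : Fin 2 → ℕ} {lam : Fin 4 → ℕ} (hmu : Antitone mu)
    (hnu : Antitone nu) (hmulam : ∑ i, mu i = ∑ i, lam i) (hnulam : ∑ i, nu i = ∑ i, lam i) :
    (kroneckerCoeff (n := 2) (m := 2) mu nu lam : ℚ) = coeffXY (deltaRatio *
      alternant ![1, xVar, yVar, xVar * yVar] (lam + staircase 4)) (mu 1) (nu 1) := by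
  rw [Fin.sum_univ_two] at hmulam hnulam
  have h := evalXY_altSchurXY (R := IterLaurent) (x := xVar) (y := yVar) (r := deltaRatio) lam
    (by rw [deltaRatio_mul_alternant])
  rw [kroneckerCoeff_eq_coeff hmu hnu, ← h,
    coeffXY_evalXY_altSchurXY lam (a := mu 0 + 1) (c := nu 0 + 1) (by omega) (by omega)]

theorem mainTheorem10 (mu nu : Fin 2 → ℕ) (lam : Fin 4 → ℕ)
    (hmu : Antitone mu) (hnu : Antitone nu) (hlam : Antitone lam)
    (hmulam : ∑ i, mu i = ∑ i, lam i) (hnulam : ∑ i, nu i = ∑ i, lam i) :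
    ((lam 2 + lam 3 ≤ nu 1 ∧ nu 1 ≤ lam 1 + lam 3) ∧
        ((lam 2 + lam 3) + (lam 1 + lam 3) ≤ mu 1 + nu 1 ∧
          mu 1 + nu 1 ≤ (lam 2 + lam 3) + min (lam 1 + lam 2) (lam 0 + lam 3)) →
      atomicCoeff mu nu lam = (kroneckerCoeff (n := 2) (m := 2) mu nu lam : ℚ)) ∧
    (lam 1 + lam 2 ≤ lam 0 + lam 3 →
      (((lam 2 + lam 3 ≤ nu 1 ∧ nu 1 ≤ lam 1 + lam 3) ∧
          ((lam 2 + lam 3) + (lam 1 + lam 3) ≤ mu 1 + nu 1 ∧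
            mu 1 + nu 1 ≤ (lam 2 + lam 3) + min (lam 1 + lam 2) (lam 0 + lam 3))) ↔
        ((lam 3 : ℤ) ≤ (mu 1 + nu 1 : ℤ) - (lam 1 + lam 2 + lam 3) ∧
          (mu 1 + nu 1 : ℤ) - (lam 1 + lam 2 + lam 3) ≤ lam 2 ∧
          (lam 2 : ℤ) ≤ (nu 1 : ℤ) - lam 3 ∧ (nu 1 : ℤ) - lam 3 ≤ lam 1)) ∧
      ((lam 3 : ℤ) ≤ (mu 1 + nu 1 : ℤ) - (lam 1 + lam 2 + lam 3) ∧
          (mu 1 + nu 1 : ℤ) - (lam 1 + lam 2 + lam 3) ≤ lam 2 ∧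
          (lam 2 : ℤ) ≤ (nu 1 : ℤ) - lam 3 ∧ (nu 1 : ℤ) - lam 3 ≤ lam 1 →
        atomicCoeff mu nu lam = (kroneckerCoeff (n := 2) (m := 2) mu nu lam : ℚ))) := by
  have main : (lam 2 + lam 3 ≤ nu 1 ∧ nu 1 ≤ lam 1 + lam 3) ∧
        ((lam 2 + lam 3) + (lam 1 + lam 3) ≤ mu 1 + nu 1 ∧
          mu 1 + nu 1 ≤ (lam 2 + lam 3) + min (lam 1 + lam 2) (lam 0 + lam 3)) →
      atomicCoeff mu nu lam = (kroneckerCoeff (n := 2) (m := 2) mu nu lam : ℚ) := by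
    rintro ⟨⟨-, h1⟩, -, h2⟩
    rw [atomicCoeff_eq hlam h1 h2, kroneckerCoeff_eq_coeffXY hmu hnu hmulam hnulam]
  -- Under `h` the minimum is `lam 1 + lam 2`, and the chain rearranges the four inequalities.
  refine ⟨main, fun h => ⟨by omega, fun hchain => main (by omega)⟩⟩
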